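/- Let $\mathcal M=(S,S_\Box,S_\bigcirc,\longrightarrow,P)$ be a finitely branching countable Markov decision process: $S$ is a countable set of states, partitioned into player states $S_\Box$ and random states $S_\bigcirc$; $\longrightarrow\;\subseteq S\times S$ is a transition relation such that every state has at least one and only finitely many successors; and $P$ assigns to each random state a probability distribution on its successors. A strategy $\sigma$ assigns to each history $w s\in S^*S_\Box$ a probability distribution on the successors of $s$; it is MD (memoryless deterministic) if this distribution depends only on $s$ and is always a Dirac distribution. Let $\mathcal P_{\mathcal M,s,\sigma}$ be the probability measure on infinite sequences of states induced by the initial state $s$ and the strategy $\sigma$. Let $\mathit{Col}:S\to\{0,1\}$ be a color function and let $\varphi$ be the $\{0,1\}$-parity (co-Büchi) objective, i.e. the set of all sequences $s_0s_1s_2\cdots$ such that the largest color occurring infinitely often among $\mathit{Col}(s_0),\mathit{Col}(s_1),\dots$ is even. Put $\mathrm{val}_{\mathcal M}(s)=\sup_\sigma \mathcal P_{\mathcal M,s,\sigma}(\varphi)$, the supremum being over all strategies. Then for every $\varepsilon>0$ there is an MD strategy $\sigma$ that is $\varepsilon$-optimal from every state, that is, $$\mathcal P_{\mathcal M,s,\sigma}(\varphi)\;\ge\;\mathrm{val}_{\mathcal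 M}(s)-\varepsilon\qquad\text{for all } s\in S.$$ -/

import Mathlib

open MeasureTheory ProbabilityTheory Filter

/-- A Markov decision process with state space `S` (assumed countable in the theorem).  The states
in `player` belong to the player, all other states are random; `step s t` means that `t` is a
successor of `s`.  Every state has a successor, and every random state carries a probability
distribution on its successors. -/
structure MDP (S : Type*) where
  player : Set S
  step : S → S → Prop
  exists_step : ∀ s, ∃ t, step s t
  prob : {s : S // s ∉ player} → PMF S
  step_of_mem_support : ∀ s t, t ∈ (prob s).support → step s t

namespace MDP

variable {S : Type*}

/-- Every state has only finitely many successors. -/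
def FinitelyBranching (M : MDP S) : Prop :=
  ∀ s, {t | M.step s t}.Finite

/-- A (history-dependent, randomized) strategy: `act w s` is the distribution on successors that
is chosen after the history `w s`, where `w` lists the states visited before the current player
state `s`, the oldest first. -/
structure Strategy (M : MDP S) where
  act : List S → M.player → PMF S
  step_of_mem_support : ∀ w s t, t ∈ (act w s).support → M.step s t

/-- The choice depends on the current state only. -/
def Strategy.IsMemoryless {M : MDP S} (σ : M.Strategy) : Prop :=
  ∃ f : M.player → PMF S, ∀ w s, σ.act w s = f s

/-- All choices are Dirac distributions. -/
def Strategy.IsDeterministic {M : MDP S} (σ : M.Strategy) : Prop :=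
  ∀ w s, ∃ t, σ.act w s = PMF.pure t

/-- Memoryless deterministic strategies. -/
def Strategy.IsMD {M : MDP S} (σ : M.Strategy) : Prop :=
  σ.IsMemoryless ∧ σ.IsDeterministic

open Classical in
/-- The distribution of the next state after the history `w s`: that of the strategy in a player
state, that of the MDP in a random state. -/
noncomputable def Strategy.next {M : MDP S} (σ : M.Strategy) (w : List S) (s : S) : PMF S :=
  if h : s ∈ M.player then σ.act w ⟨s, h⟩ else M.prob ⟨s, h⟩

section Measure

variable [Countable S] [MeasurableSpace S] [DiscreteMeasurableSpace S]

/-- The transition kernel from the states at times `0, …, n` to the state at time `n + 1`. -/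
noncomputable def Strategy.kernel {M : MDP S} (σ : M.Strategy) (n : ℕ) :
    Kernel ((i : Finset.Iic n) → (fun _ : ℕ => S) i) S where
  toFun h := (σ.next
    (List.ofFn fun i : Fin n => h ⟨i, Finset.mem_Iic.2 i.isLt.le⟩)
    (h ⟨n, Finset.mem_Iic.2 le_rfl⟩)).toMeasure
  measurable' := measurable_of_countable _

instance {M : MDP S} (σ : M.Strategy) (n : ℕ) : IsMarkovKernel (σ.kernel n) where
  isProbabilityMeasure _ := PMF.toMeasure.isProbabilityMeasure (σ.next _ _)

/-- The probability measure on infinite sequences of states that is induced by the strategy `σ`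
and the initial state `s₀`, given by the Ionescu-Tulcea extension of the kernels above. -/
noncomputable def Strategy.measure {M : MDP S} (σ : M.Strategy) (s₀ : S) : Measure (ℕ → S) :=
  Kernel.traj (X := fun _ => S) σ.kernel 0 (fun _ => s₀)

/-- The value of the state `s` for the objective `φ`. -/
noncomputable def value (M : MDP S) (φ : Set (ℕ → S)) (s : S) : ℝ :=
  ⨆ σ : M.Strategy, (σ.measure s).real φ

/-- `σ` is `ε`-optimal from the state `s` for the objective `φ`. -/
def Strategy.IsEpsOptimal {M : MDP S} (σ : M.Strategy) (φ : Set (ℕ → S)) (ε : ℝ) (s : S) : Prop :=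
  (σ.measure s).real φ ≥ M.value φ s - ε

end Measure

end MDP

/-- The parity objective: some even color occurs infinitely often, and from some time on no
larger color occurs. -/
def parity {S : Type*} (col : S → ℕ) : Set (ℕ → S) :=
  {w | ∃ i : ℕ, (∃ᶠ n in atTop, col (w n) = 2 * i) ∧ ∀ᶠ n in atTop, col (w n) ≤ 2 * i}

/-!
Let `b x` be the least probability of visiting the set `B` of states of color `1` from `x`. As long
as a play is outside `{b ≤ γ}`, it will visit `B` with probability greater than `γ`, so almost
surely a play that never enters `{b ≤ γ}` visits `B` infinitely often. Hence the value of the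
objective is at most that of reaching `{b ≤ γ}`, for every `γ > 0`.

An MD strategy that minimizes the probability of visiting `B` also almost surely reaches `B` or
`{b ≤ γ * γ}`, hence it reaches `{b ≤ γ * γ}` from `{b ≤ γ}` with probability at least `1 - γ`. So
one commits to it in `{b ≤ γ}`, and elsewhere follows an MD strategy that is nearly optimal,
uniformly in the initial state, for reaching `{b ≤ γ * γ}`; it exists by Ornstein's theorem. Until
`B` is visited, `b` is a martingale under the minimizing strategy, so from `{b ≤ γ * γ}` a state
with `b > γ`, and in particular `B`, is reached with probability at most `γ`.
-/

open scoped ENNReal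

/-- A gambling house in the sense of Dubins and Savage: in the state `x`, the law of the next state
may be chosen from `Γ x`. -/
abbrev GamblingHouse (S : Type*) :=
  S → Set (PMF S)

namespace GamblingHouse

section Selector

variable {S : Type*}

/-- In every state there are only finitely many choices, and at least one. -/
structure IsFinitary (Γ : GamblingHouse S) : Prop where
  nonempty : ∀ x, (Γ x).Nonempty
  finite : ∀ x, (Γ x).Finite

/-- `τ` is a rule for choosing from `Γ` that depends on the current state only. -/
def IsSelector (Γ : GamblingHouse S) (τ : S → PMF S) : Prop :=
  ∀ x, τ x ∈ Γ x

/-- The house with no choice but to follow `τ`, so that its values are probabilities for the Markov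
chain with transition law `τ`. -/
def stationary (τ : S → PMF S) : GamblingHouse S :=
  fun x => {τ x}

open Classical in
/-- The house `Γ` in which one is committed to following `τ` in the states of `A`. -/
noncomputable def commit (Γ : GamblingHouse S) (A : Set S) (τ : S → PMF S) : GamblingHouse S :=
  A.piecewise (stationary τ) Γ

variable {Γ : GamblingHouse S} {A : Set S} {τ σ : S → PMF S}

lemma commit_of_mem {x : S} (hx : x ∈ A) : Γ.commit A τ x = {τ x} :=
  if_pos hx

lemma commit_of_notMem {x : S} (hx : x ∉ A) : Γ.commit A τ x = Γ x :=
  if_neg hx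

lemma IsSelector.commit_subset (hτ : Γ.IsSelector τ) (x : S) : Γ.commit A τ x ⊆ Γ x := by
  by_cases hx : x ∈ A
  · simpa [commit_of_mem hx] using hτ x
  · rw [commit_of_notMem hx]

lemma IsSelector.commit (hτ : Γ.IsSelector τ) : (Γ.commit A τ).IsSelector τ := fun x => by
  by_cases hx : x ∈ A
  · simp [commit_of_mem hx]
  · simpa [commit_of_notMem hx] using hτ x

lemma IsFinitary.commit (hΓ : Γ.IsFinitary) (hτ : Γ.IsSelector τ) : (Γ.commit A τ).IsFinitary where
  nonempty x := ⟨τ x, hτ.commit x⟩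
  finite x := (hΓ.finite x).subset (hτ.commit_subset x)

lemma IsSelector.eq_of_mem_commit (hσ : (Γ.commit A τ).IsSelector σ) {x : S} (hx : x ∈ A) :
    σ x = τ x := by
  simpa [commit_of_mem hx] using hσ x

lemma IsFinitary.exists_isSelector_forall_le (hΓ : Γ.IsFinitary) {β : Type*} [LinearOrder β]
    (φ : PMF S → β) : ∃ τ, Γ.IsSelector τ ∧ ∀ x, ∀ p ∈ Γ x, φ (τ x) ≤ φ p := by
  choose τ hτ hmin using fun x => (Γ x).exists_min_image φ (hΓ.finite x) (hΓ.nonempty x)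
  exact ⟨τ, hτ, hmin⟩

lemma exists_forall_isSelector_of_antitone {Γ : ℕ → GamblingHouse S} (hΓ : ∀ n, (Γ n).IsFinitary)
    (hanti : ∀ n x, Γ (n + 1) x ⊆ Γ n x) : ∃ τ, ∀ n, (Γ n).IsSelector τ := by
  have hne : ∀ x, (⋂ n, Γ n x).Nonempty := fun x => by
    let _ : TopologicalSpace (PMF S) := ⊥
    have : DiscreteTopology (PMF S) := ⟨rfl⟩
    exact IsCompact.nonempty_iInter_of_sequence_nonempty_isCompact_isClosed _ (fun n => hanti n x)
      (fun n => (hΓ n).nonempty x) ((hΓ 0).finite x).isCompact fun n => isClosed_discrete _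
  choose τ hτ using hne
  exact ⟨τ, fun n x => Set.mem_iInter.1 (hτ x) n⟩

end Selector

section Reach

variable {S : Type*} [MeasurableSpace S] (Γ : GamblingHouse S)

open Classical in
/-- One step of value iteration for reaching `T`, discounted by `l`. -/
noncomputable def reachStep (l : ℝ≥0∞) (T : Set S) : (S → ℝ≥0∞) →o (S → ℝ≥0∞) where
  toFun f x := if x ∈ T then 1 else l * ⨆ p ∈ Γ x, ∫⁻ y, f y ∂p.toMeasure
  monotone' f g hfg x := by
    dsimp only
    split_ifs
    · rfl
    · gcongr with p _ y
      exact hfg y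

open Classical in
/-- One step of value iteration for reaching `T`, with choices made in order not to reach it. -/
noncomputable def minReachStep (T : Set S) : (S → ℝ≥0∞) →o (S → ℝ≥0∞) where
  toFun f x := if x ∈ T then 1 else ⨅ p ∈ Γ x, ∫⁻ y, f y ∂p.toMeasure
  monotone' f g hfg x := by
    dsimp only
    split_ifs
    · rfl
    · gcongr with p _ y
      exact hfg y

/-- The greatest expectation of `l ^ N` that choices from `Γ` can achieve, where `N` is the time at
which `T` is reached. -/
noncomputable def discountedReachValue (l : ℝ≥0∞) (T : Set S) : S → ℝ≥0∞ :=
  (Γ.reachStep l T).lfp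

/-- The optimal probability of reaching `T` with choices from `Γ`. -/
noncomputable def reachValue (T : Set S) : S → ℝ≥0∞ :=
  Γ.discountedReachValue 1 T

/-- The least probability of reaching `T` with choices from `Γ`. -/
noncomputable def minReachValue (T : Set S) : S → ℝ≥0∞ :=
  (Γ.minReachStep T).lfp

variable {Γ} {Δ : GamblingHouse S} {l : ℝ≥0∞} {T U : Set S} {f : S → ℝ≥0∞} {x : S}
  {τ σ : S → PMF S}

lemma discountedReachValue_of_mem (hx : x ∈ T) : Γ.discountedReachValue l T x = 1 :=
  (congrFun (Γ.reachStep l T).map_lfp x).symm.trans (if_pos hx)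

lemma discountedReachValue_of_notMem (hx : x ∉ T) :
    Γ.discountedReachValue l T x =
      l * ⨆ p ∈ Γ x, ∫⁻ y, Γ.discountedReachValue l T y ∂p.toMeasure :=
  (congrFun (Γ.reachStep l T).map_lfp x).symm.trans (if_neg hx)

lemma mul_lintegral_discountedReachValue_le (hx : x ∉ T) {p : PMF S} (hp : p ∈ Γ x) :
    l * ∫⁻ y, Γ.discountedReachValue l T y ∂p.toMeasure ≤ Γ.discountedReachValue l T x := by
  rw [discountedReachValue_of_notMem hx]
  gcongr
  exact le_iSup₂ (f := fun q (_ : q ∈ Γ x) => ∫⁻ y, _ ∂q.toMeasure) p hp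

lemma discountedReachValue_le (hT : ∀ x ∈ T, 1 ≤ f x)
    (hf : ∀ x ∉ T, ∀ p ∈ Γ x, l * ∫⁻ y, f y ∂p.toMeasure ≤ f x) :
    Γ.discountedReachValue l T ≤ f := by
  refine OrderHom.lfp_le _ fun x => ?_
  by_cases hx : x ∈ T
  · exact (if_pos hx).trans_le (hT x hx)
  · refine (if_neg hx).trans_le ?_
    simpa only [ENNReal.mul_iSup, iSup_le_iff] using hf x hx

lemma discountedReachValue_le_one (hl : l ≤ 1) (x : S) : Γ.discountedReachValue l T x ≤ 1 :=
  discountedReachValue_le (f := fun _ => 1) (fun _ _ => le_rfl) (fun _ _ _ _ => by simpa using hl) x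

lemma discountedReachValue_mono {l' : ℝ≥0∞} (hl : l ≤ l') :
    Γ.discountedReachValue l T ≤ Γ.discountedReachValue l' T :=
  discountedReachValue_le (fun _ hx => (discountedReachValue_of_mem hx).ge) fun _ hx _ hp =>
    (mul_le_mul_left hl _).trans (mul_lintegral_discountedReachValue_le hx hp)

lemma reachValue_of_mem (hx : x ∈ T) : Γ.reachValue T x = 1 :=
  discountedReachValue_of_mem hx

lemma lintegral_reachValue_le (hx : x ∉ T) {p : PMF S} (hp : p ∈ Γ x) :
    ∫⁻ y, Γ.reachValue T y ∂p.toMeasure ≤ Γ.reachValue T x :=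
  (one_mul _).ge.trans (mul_lintegral_discountedReachValue_le hx hp)

lemma reachValue_le (hT : ∀ x ∈ T, 1 ≤ f x)
    (hf : ∀ x ∉ T, ∀ p ∈ Γ x, ∫⁻ y, f y ∂p.toMeasure ≤ f x) : Γ.reachValue T ≤ f :=
  discountedReachValue_le hT (by simpa only [one_mul] using hf)

lemma reachValue_le_one (x : S) : Γ.reachValue T x ≤ 1 :=
  discountedReachValue_le_one le_rfl x

lemma reachValue_ne_top (x : S) : Γ.reachValue T x ≠ ∞ :=
  ne_top_of_le_ne_top ENNReal.one_ne_top (reachValue_le_one x)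

lemma reachValue_mono (h : ∀ x, Γ x ⊆ Δ x) : Γ.reachValue T ≤ Δ.reachValue T :=
  reachValue_le (fun _ hx => (reachValue_of_mem hx).ge) fun x hx _ hp =>
    lintegral_reachValue_le hx (h x hp)

lemma IsSelector.reachValue_stationary_le (hτ : Γ.IsSelector τ) :
    (stationary τ).reachValue T ≤ Γ.reachValue T :=
  reachValue_mono fun x => Set.singleton_subset_iff.2 (hτ x)

lemma lintegral_reachValue_stationary_le (hx : x ∉ T) :
    ∫⁻ y, (stationary τ).reachValue T y ∂(τ x).toMeasure ≤ (stationary τ).reachValue T x :=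
  lintegral_reachValue_le hx rfl

/-- It suffices that `g` is superharmonic where the bound is not already known, because then
`min (Γ.reachValue T) (c⁻¹ * g)` is superharmonic off `T`. -/
lemma mul_reachValue_le {c : ℝ≥0∞} (hc : c ≠ ∞) {g : S → ℝ≥0∞} (hT : ∀ x ∈ T, c ≤ g x)
    (hg : ∀ x ∉ T, c * Γ.reachValue T x ≤ g x ∨ ∀ p ∈ Γ x, ∫⁻ y, g y ∂p.toMeasure ≤ g x) (x : S) :
    c * Γ.reachValue T x ≤ g x := by
  rcases eq_or_ne c 0 with rfl | hc0
  · simp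
  have hle : Γ.reachValue T ≤ fun x => min (Γ.reachValue T x) (c⁻¹ * g x) := by
    refine reachValue_le (fun x hx => le_min (reachValue_of_mem hx).ge ?_)
      fun x hx p hp => le_min ?_ ?_
    · exact (ENNReal.inv_mul_cancel hc0 hc).ge.trans (mul_le_mul_right (hT x hx) _)
    · exact (lintegral_mono fun y => min_le_left _ _).trans (lintegral_reachValue_le hx hp)
    · rcases hg x hx with hbound | hsuper
      · calc ∫⁻ y, min (Γ.reachValue T y) (c⁻¹ * g y) ∂p.toMeasure
            ≤ ∫⁻ y, Γ.reachValue T y ∂p.toMeasure := lintegral_mono fun y => min_le_left _ _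
          _ ≤ Γ.reachValue T x := lintegral_reachValue_le hx hp
          _ ≤ c⁻¹ * g x := (ENNReal.mul_le_iff_le_inv hc0 hc).1 hbound
      · calc ∫⁻ y, min (Γ.reachValue T y) (c⁻¹ * g y) ∂p.toMeasure
            ≤ ∫⁻ y, c⁻¹ * g y ∂p.toMeasure := lintegral_mono fun y => min_le_right _ _
          _ = c⁻¹ * ∫⁻ y, g y ∂p.toMeasure := lintegral_const_mul' _ _ (ENNReal.inv_ne_top.2 hc0)
          _ ≤ c⁻¹ * g x := by gcongr; exact hsuper p hp
  exact (ENNReal.mul_le_iff_le_inv hc0 hc).2 ((hle x).trans (min_le_right _ _))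

lemma mul_reachValue_le_commit {A : Set S} (hτ : Γ.IsSelector τ) {c : ℝ≥0∞} (hc : c ≤ 1)
    (hT : T ⊆ A ∪ U)
    (hA : ∀ x ∈ A, c * Γ.reachValue T x ≤ (stationary τ).reachValue U x) (x : S) :
    c * Γ.reachValue T x ≤ (Γ.commit A τ).reachValue U x := by
  have hc_mul (x : S) : c * Γ.reachValue T x ≤ 1 := mul_le_one' hc (reachValue_le_one x)
  have hA' (x : S) (hx : x ∈ A) : c * Γ.reachValue T x ≤ (Γ.commit A τ).reachValue U x :=
    (hA x hx).trans (hτ.commit.reachValue_stationary_le x)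
  refine mul_reachValue_le (ne_top_of_le_ne_top ENNReal.one_ne_top hc) (fun x hx => ?_)
    (fun x _ => ?_) x
  · rcases hT hx with hxA | hxU
    · simpa [reachValue_of_mem hx] using hA' x hxA
    · rwa [reachValue_of_mem hxU]
  · by_cases hxA : x ∈ A
    · exact .inl (hA' x hxA)
    by_cases hxU : x ∈ U
    · exact .inl ((hc_mul x).trans (reachValue_of_mem hxU).ge)
    · exact .inr fun p hp => lintegral_reachValue_le hxU (by rwa [commit_of_notMem hxA])

lemma minReachValue_of_mem (hx : x ∈ T) : Γ.minReachValue T x = 1 :=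
  (congrFun (Γ.minReachStep T).map_lfp x).symm.trans (if_pos hx)

lemma minReachValue_of_notMem (hx : x ∉ T) :
    Γ.minReachValue T x = ⨅ p ∈ Γ x, ∫⁻ y, Γ.minReachValue T y ∂p.toMeasure :=
  (congrFun (Γ.minReachStep T).map_lfp x).symm.trans (if_neg hx)

lemma minReachValue_le (hT : ∀ x ∈ T, 1 ≤ f x)
    (hf : ∀ x ∉ T, ∃ p ∈ Γ x, ∫⁻ y, f y ∂p.toMeasure ≤ f x) : Γ.minReachValue T ≤ f := by
  refine OrderHom.lfp_le _ fun x => ?_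
  by_cases hx : x ∈ T
  · exact (if_pos hx).trans_le (hT x hx)
  · obtain ⟨p, hp, hle⟩ := hf x hx
    exact (if_neg hx).trans_le (iInf₂_le_of_le p hp hle)

lemma IsSelector.minReachValue_le_reachValue_stationary (hτ : Γ.IsSelector τ) :
    Γ.minReachValue T ≤ (stationary τ).reachValue T :=
  minReachValue_le (fun _ hx => (reachValue_of_mem hx).ge) fun x hx =>
    ⟨τ x, hτ x, lintegral_reachValue_stationary_le hx⟩

lemma IsFinitary.exists_isSelector_reachValue_eq_minReachValue (hΓ : Γ.IsFinitary) (T : Set S) :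
    ∃ τ, Γ.IsSelector τ ∧ (stationary τ).reachValue T = Γ.minReachValue T := by
  obtain ⟨τ, hτ, hmin⟩ :=
    hΓ.exists_isSelector_forall_le fun p => ∫⁻ y, Γ.minReachValue T y ∂p.toMeasure
  refine ⟨τ, hτ, le_antisymm (reachValue_le (fun x hx => (minReachValue_of_mem hx).ge) ?_)
    hτ.minReachValue_le_reachValue_stationary⟩
  rintro x hx _ rfl
  rw [minReachValue_of_notMem hx]
  exact le_iInf₂ (hmin x)

end Reach


section AlmostSureReach

variable {S : Type*} [MeasurableSpace S] {Γ : GamblingHouse S} {B : Set S} {θ : ℝ≥0∞}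

/-- If `m = ⨅ y, H y` were less than `1`, then `(H - m) / (1 - m)` would bound `Γ.minReachValue B`,
hence be at least `θ` wherever `H < 1`, so that `H` would be bounded away from `m`. -/
lemma one_le_of_minReachValue_le_imp {H : S → ℝ≥0∞} (hθ : θ ≠ 0)
    (hθH : ∀ x, Γ.minReachValue B x ≤ θ → 1 ≤ H x) (hB : ∀ x ∈ B, 1 ≤ H x)
    (hH : ∀ x ∉ B, ∃ p ∈ Γ x, ∫⁻ y, H y ∂p.toMeasure ≤ H x) (x : S) : 1 ≤ H x := by
  set m := ⨅ y, H y
  have m_le (y : S) : m ≤ H y := iInf_le H y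
  refine le_trans ?_ (m_le x)
  by_contra! hm1
  have m_ne_top : m ≠ ∞ := hm1.ne_top
  have gap_ne_zero : 1 - m ≠ 0 := (tsub_pos_of_lt hm1).ne'
  have le_scaled_iff (a : ℝ≥0∞) (y : S) : (1 - m) * a ≤ H y - m ↔ a ≤ (1 - m)⁻¹ * (H y - m) :=
    ENNReal.mul_le_iff_le_inv gap_ne_zero (by simp)
  have minReachValue_le_scaled : Γ.minReachValue B ≤ fun y => (1 - m)⁻¹ * (H y - m) := by
    refine minReachValue_le (fun y hy => ?_) fun y hy => ?_
    · rw [← le_scaled_iff, mul_one]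
      exact tsub_le_tsub_right (hB y hy) m
    · obtain ⟨p, hp, hpH⟩ := hH y hy
      refine ⟨p, hp, ?_⟩
      rw [lintegral_const_mul' _ _ (ENNReal.inv_ne_top.2 gap_ne_zero)]
      gcongr
      refine ENNReal.le_sub_of_add_le_right m_ne_top ?_
      calc ∫⁻ z, (H z - m) ∂p.toMeasure + m
          = ∫⁻ z, (H z - m + m) ∂p.toMeasure := by
            rw [lintegral_add_right _ measurable_const]
            simp
        _ = ∫⁻ z, H z ∂p.toMeasure := lintegral_congr fun z => tsub_add_cancel_of_le (m_le z)
        _ ≤ H y := hpH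
  have add_le (y : S) : m + (1 - m) * min θ 1 ≤ H y := by
    rcases le_or_gt (Γ.minReachValue B y) θ with hy | hy
    · calc m + (1 - m) * min θ 1 ≤ m + (1 - m) := by
            gcongr
            exact mul_le_of_le_one_right' (min_le_right _ _)
        _ = 1 := add_tsub_cancel_of_le hm1.le
        _ ≤ H y := hθH y hy
    · have le_sub : (1 - m) * min θ 1 ≤ H y - m :=
        (le_scaled_iff _ y).2 ((min_le_left _ _).trans (hy.le.trans (minReachValue_le_scaled y)))
      calc m + (1 - m) * min θ 1 ≤ m + (H y - m) := by gcongr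
        _ = H y := add_tsub_cancel_of_le (m_le y)
  exact (ENNReal.lt_add_right m_ne_top (mul_ne_zero gap_ne_zero (by simp [hθ]))).not_ge
    (le_iInf add_le)

lemma IsSelector.one_le_reachValue_stationary_union {τ : S → PMF S} (hτ : Γ.IsSelector τ)
    (hθ : θ ≠ 0) (x : S) :
    1 ≤ (stationary τ).reachValue ({y | Γ.minReachValue B y ≤ θ} ∪ B) x := by
  refine one_le_of_minReachValue_le_imp (Γ := Γ) (B := B)
    (H := (stationary τ).reachValue ({y | Γ.minReachValue B y ≤ θ} ∪ B)) hθ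
    (fun y hy => (reachValue_of_mem (.inl hy)).ge) (fun y hy => (reachValue_of_mem (.inr hy)).ge)
    (fun y hy => ⟨τ y, hτ y, ?_⟩) x
  by_cases hyθ : Γ.minReachValue B y ≤ θ
  · rw [reachValue_of_mem (.inl hyθ)]
    exact (lintegral_mono reachValue_le_one).trans (by simp)
  · exact lintegral_reachValue_stationary_le (not_or.2 ⟨hyθ, hy⟩)

lemma IsFinitary.one_le_minReachValue_union (hΓ : Γ.IsFinitary) (hθ : θ ≠ 0) (x : S) :
    1 ≤ Γ.minReachValue ({y | Γ.minReachValue B y ≤ θ} ∪ B) x := by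
  obtain ⟨τ, hτ, heq⟩ := hΓ.exists_isSelector_reachValue_eq_minReachValue
    ({y | Γ.minReachValue B y ≤ θ} ∪ B)
  exact (hτ.one_le_reachValue_stationary_union hθ x).trans_eq (congrFun heq x)

end AlmostSureReach

section Ornstein

variable {S : Type*} [MeasurableSpace S] {Γ : GamblingHouse S} {κ l e : ℝ≥0∞} {T : Set S}
  {τ σ : S → PMF S}

lemma le_reachValue_stationary_of_le_mul_lintegral {f : S → ℝ≥0∞} (hl : l < 1) (hf1 : ∀ x, f x ≤ 1)
    (hf : ∀ x ∉ T, f x ≤ l * ∫⁻ y, f y ∂(τ x).toMeasure) (x : S) :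
    f x ≤ (stationary τ).reachValue T x := by
  have le_add_pow : ∀ (n : ℕ) (x : S), f x ≤ (stationary τ).reachValue T x + l ^ n := by
    intro n
    induction n with
    | zero => exact fun x => (hf1 x).trans (by simp)
    | succ n ih =>
      intro x
      by_cases hx : x ∈ T
      · exact ((hf1 x).trans (reachValue_of_mem hx).ge).trans le_self_add
      calc f x ≤ l * ∫⁻ y, ((stationary τ).reachValue T y + l ^ n) ∂(τ x).toMeasure :=
            (hf x hx).trans (by gcongr with y; exact ih y)
        _ = l * ∫⁻ y, (stationary τ).reachValue T y ∂(τ x).toMeasure + l ^ (n + 1) := by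
            rw [lintegral_add_right _ measurable_const, mul_add, pow_succ']
            simp
        _ ≤ (stationary τ).reachValue T x + l ^ (n + 1) := by
            gcongr
            exact (mul_le_of_le_one_left' hl.le).trans (lintegral_reachValue_stationary_le hx)
  have tendsto_add_pow := (ENNReal.tendsto_pow_atTop_nhds_zero_of_lt_one hl).const_add
    ((stationary τ).reachValue T x)
  rw [add_zero] at tendsto_add_pow
  exact ge_of_tendsto' tendsto_add_pow fun n => le_add_pow n x

lemma IsFinitary.exists_isSelector_discountedReachValue_le (hΓ : Γ.IsFinitary) (hl : l < 1) :
    ∃ τ, Γ.IsSelector τ ∧ ∀ x, Γ.discountedReachValue l T x ≤ (stationary τ).reachValue T x := by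
  obtain ⟨τ, hτ, hmax⟩ := hΓ.exists_isSelector_forall_le
    fun p => OrderDual.toDual (∫⁻ y, Γ.discountedReachValue l T y ∂p.toMeasure)
  refine ⟨τ, hτ, le_reachValue_stationary_of_le_mul_lintegral hl
    (discountedReachValue_le_one hl.le) fun x hx => ?_⟩
  rw [discountedReachValue_of_notMem hx]
  gcongr
  exact iSup₂_le (hmax x)

variable [DiscreteMeasurableSpace S]

lemma reachValue_le_iSup_discountedReachValue {r : ℕ → ℝ≥0∞} (hr : Monotone r)
    (hr1 : ⨆ n, r n = 1) (x : S) :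
    Γ.reachValue T x ≤ ⨆ n, Γ.discountedReachValue (r n) T x := by
  have hmono : Monotone fun n => Γ.discountedReachValue (r n) T :=
    fun _ _ h => discountedReachValue_mono (hr h)
  refine reachValue_le (f := fun x => ⨆ n, Γ.discountedReachValue (r n) T x) (fun x hx => ?_)
    (fun x hx p hp => ?_) x
  · simp [discountedReachValue_of_mem hx]
  calc ∫⁻ y, ⨆ n, Γ.discountedReachValue (r n) T y ∂p.toMeasure
      = (⨆ m, r m) * ⨆ n, ∫⁻ y, Γ.discountedReachValue (r n) T y ∂p.toMeasure := by
        rw [lintegral_iSup (fun _ => .of_discrete) hmono, hr1, one_mul]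
    _ = ⨆ (n) (m), r m * ∫⁻ y, Γ.discountedReachValue (r n) T y ∂p.toMeasure := by
        simp only [ENNReal.iSup_mul, ENNReal.mul_iSup]
    _ ≤ ⨆ n, Γ.discountedReachValue (r n) T x := iSup₂_le fun n m => by
        refine le_iSup_of_le (max m n) (le_trans ?_ (mul_lintegral_discountedReachValue_le hx hp))
        exact mul_le_mul' (hr (le_max_left m n)) (lintegral_mono (hmono (le_max_right m n)))

lemma IsFinitary.exists_isSelector_mul_reachValue_le_at (hΓ : Γ.IsFinitary) (hκ : κ < 1)
    (T : Set S) (s : S) :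
    ∃ τ, Γ.IsSelector τ ∧ κ * Γ.reachValue T s ≤ (stationary τ).reachValue T s := by
  obtain ⟨r, hr, hr1, hr_tendsto⟩ := exists_seq_strictMono_tendsto' (zero_lt_one' ℝ≥0∞)
  rcases eq_or_ne (Γ.reachValue T s) 0 with h0 | h0
  · obtain ⟨τ, hτ, -⟩ := hΓ.exists_isSelector_discountedReachValue_le (T := T) zero_lt_one
    exact ⟨τ, hτ, by simp [h0]⟩
  have hlt : κ * Γ.reachValue T s < ⨆ n, Γ.discountedReachValue (r n) T s :=
    calc κ * Γ.reachValue T s < 1 * Γ.reachValue T s :=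
          ENNReal.mul_lt_mul_left h0 (reachValue_ne_top s) hκ
      _ = Γ.reachValue T s := one_mul _
      _ ≤ ⨆ n, Γ.discountedReachValue (r n) T s :=
          reachValue_le_iSup_discountedReachValue hr.monotone
            (iSup_eq_of_tendsto hr.monotone hr_tendsto) s
  obtain ⟨n, hn⟩ := lt_iSup_iff.1 hlt
  obtain ⟨τ, hτ, hle⟩ := hΓ.exists_isSelector_discountedReachValue_le (T := T) (hr1 n).2
  exact ⟨τ, hτ, hn.le.trans (hle s)⟩

lemma reachValue_stationary_le_add (hκe : 1 ≤ e + κ)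
    (hστ : ∀ x, κ * Γ.reachValue T x ≤ (stationary τ).reachValue T x → σ x = τ x)
    (hτ : Γ.IsSelector τ) (x : S) :
    (stationary τ).reachValue T x ≤ e * (stationary σ).reachValue T x + κ * Γ.reachValue T x := by
  rw [← one_mul ((stationary τ).reachValue T x)]
  refine mul_reachValue_le ENNReal.one_ne_top (g := fun x =>
    e * (stationary σ).reachValue T x + κ * Γ.reachValue T x) (fun x hx => ?_) (fun x hx => ?_) x
  · simpa only [reachValue_of_mem hx, mul_one] using hκe
  rcases le_or_gt (κ * Γ.reachValue T x) ((stationary τ).reachValue T x) with hle | hlt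
  · refine .inr ?_
    rintro _ rfl
    rw [lintegral_add_left .of_discrete, lintegral_const_mul _ .of_discrete,
      lintegral_const_mul _ .of_discrete]
    gcongr
    · rw [← hστ x hle]
      exact lintegral_reachValue_stationary_le hx
    · exact lintegral_reachValue_le hx (hτ x)
  · exact .inl ((one_mul _).trans_le (hlt.le.trans le_add_self))

/-- Wherever a selector that is nearly optimal at `s` is nearly optimal, one commits to it. -/
lemma IsFinitary.exists_refinement (hΓ : Γ.IsFinitary) (hκ : κ < 1) (T : Set S) (s : S) :
    ∃ Δ : GamblingHouse S, Δ.IsFinitary ∧ (∀ x, Δ x ⊆ Γ x) ∧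
      (∀ x, κ * Γ.reachValue T x ≤ Δ.reachValue T x) ∧
      ∀ σ, Δ.IsSelector σ → κ * Γ.reachValue T s ≤ (stationary σ).reachValue T s := by
  have κ_ne_top : κ ≠ ∞ := hκ.ne_top
  set e := 1 - κ
  have e_ne_zero : e ≠ 0 := (tsub_pos_of_lt hκ).ne'
  have e_ne_top : e ≠ ∞ := ENNReal.sub_ne_top ENNReal.one_ne_top
  have e_add : e + κ = 1 := tsub_add_cancel_of_le hκ.le
  have loss_lt_one : e * κ + κ < 1 := by
    rw [← e_add, ENNReal.add_lt_add_iff_right κ_ne_top]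
    simpa using ENNReal.mul_lt_mul_right e_ne_zero e_ne_top hκ
  obtain ⟨τ, hτ, hs⟩ := hΓ.exists_isSelector_mul_reachValue_le_at loss_lt_one T s
  refine ⟨Γ.commit {x | κ * Γ.reachValue T x ≤ (stationary τ).reachValue T x} τ, hΓ.commit hτ,
    hτ.commit_subset, mul_reachValue_le_commit hτ hκ.le Set.subset_union_right fun x hx => hx,
    fun σ hσ => ?_⟩
  have hle : e * (κ * Γ.reachValue T s) + κ * Γ.reachValue T s ≤
      e * (stationary σ).reachValue T s + κ * Γ.reachValue T s :=
    calc e * (κ * Γ.reachValue T s) + κ * Γ.reachValue T s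
        = (e * κ + κ) * Γ.reachValue T s := by ring
      _ ≤ (stationary τ).reachValue T s := hs
      _ ≤ e * (stationary σ).reachValue T s + κ * Γ.reachValue T s :=
          reachValue_stationary_le_add e_add.ge (fun x hx => hσ.eq_of_mem_commit hx) hτ s
  exact (ENNReal.mul_le_mul_iff_right e_ne_zero e_ne_top).1
    ((ENNReal.add_le_add_iff_right (ENNReal.mul_ne_top κ_ne_top (reachValue_ne_top s))).1 hle)

lemma IsFinitary.exists_refinement_seq (hΓ : Γ.IsFinitary) (hκ : κ < 1) (T : Set S) (s : ℕ → S) :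
    ∃ Δ : ℕ → GamblingHouse S, Δ 0 = Γ ∧ (∀ n, (Δ n).IsFinitary) ∧
      (∀ n x, Δ (n + 1) x ⊆ Δ n x) ∧ ∀ n σ, (Δ (n + 1)).IsSelector σ →
        κ * Γ.reachValue T (s n) ≤ (stationary σ).reachValue T (s n) := by
  obtain ⟨c, hc, hcκ, -⟩ := exists_seq_strictAnti_tendsto' hκ
  let Good (n : ℕ) (Δ : GamblingHouse S) : Prop :=
    Δ.IsFinitary ∧ ∀ x, c n * Γ.reachValue T x ≤ Δ.reachValue T x
  have exists_next (n : ℕ) (Δ : GamblingHouse S) (hΔ : Good n Δ) :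
      ∃ Δ', Good (n + 1) Δ' ∧ (∀ x, Δ' x ⊆ Δ x) ∧ ∀ σ, Δ'.IsSelector σ →
        κ * Γ.reachValue T (s n) ≤ (stationary σ).reachValue T (s n) := by
    have cn_ne_zero : c n ≠ 0 := (zero_le.trans_lt (hcκ n).1).ne'
    have cn_ne_top : c n ≠ ∞ := (hcκ n).2.ne_top
    have ratio_lt_one : c (n + 1) / c n < 1 :=
      ENNReal.div_lt_of_lt_mul ((hc n.lt_succ_self).trans_eq (one_mul _).symm)
    have le_ratio_mul (x : S) :
        c (n + 1) * Γ.reachValue T x ≤ c (n + 1) / c n * Δ.reachValue T x :=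
      calc c (n + 1) * Γ.reachValue T x = c (n + 1) / c n * (c n * Γ.reachValue T x) := by
            rw [← mul_assoc, ENNReal.div_mul_cancel cn_ne_zero cn_ne_top]
        _ ≤ c (n + 1) / c n * Δ.reachValue T x := by gcongr; exact hΔ.2 x
    obtain ⟨Δ', hfin, hsub, hle, hsel⟩ := hΔ.1.exists_refinement ratio_lt_one T (s n)
    refine ⟨Δ', ⟨hfin, fun x => (le_ratio_mul x).trans (hle x)⟩, hsub, fun σ hσ => ?_⟩
    exact (mul_le_mul_left (hcκ (n + 1)).1.le _).trans ((le_ratio_mul (s n)).trans (hsel σ hσ))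
  choose! next hnext using exists_next
  let Δ (n : ℕ) : GamblingHouse S := n.rec Γ next
  have good (n : ℕ) : Good n (Δ n) := by
    induction n with
    | zero => exact ⟨hΓ, fun x => mul_le_of_le_one_left' (hcκ 0).2.le⟩
    | succ n ih => exact (hnext n _ ih).1
  exact ⟨Δ, rfl, fun n => (good n).1, fun n => (hnext n _ (good n)).2.1,
    fun n => (hnext n _ (good n)).2.2⟩

/-- **Ornstein's theorem**, for finitely many choices in every state. -/
theorem IsFinitary.exists_isSelector_mul_reachValue_le [Countable S] (hΓ : Γ.IsFinitary)
    (hκ : κ < 1) (T : Set S) :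
    ∃ σ, Γ.IsSelector σ ∧ ∀ x, κ * Γ.reachValue T x ≤ (stationary σ).reachValue T x := by
  rcases isEmpty_or_nonempty S with hS | hS
  · exact ⟨fun x => hS.elim x, fun x => hS.elim x, fun x => hS.elim x⟩
  obtain ⟨s, hs⟩ := exists_surjective_nat S
  obtain ⟨Δ, hΔ0, hfin, hanti, hΔ⟩ := hΓ.exists_refinement_seq hκ T s
  obtain ⟨σ, hσ⟩ := exists_forall_isSelector_of_antitone hfin hanti
  refine ⟨σ, hΔ0 ▸ hσ 0, fun x => ?_⟩
  obtain ⟨n, rfl⟩ := hs x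
  exact hΔ n σ (hσ (n + 1))

end Ornstein

section Switching

variable {S : Type*} [MeasurableSpace S] {Γ : GamblingHouse S}
  {B : Set S} {γ δ η κ : ℝ≥0∞} {τ σ : S → PMF S}

lemma mul_reachValue_stationary_le_minReachValue
    (hτB : (stationary τ).reachValue B = Γ.minReachValue B) (hγ : γ ≤ 1)
    (hστ : ∀ x, Γ.minReachValue B x ≤ γ → σ x = τ x) (x : S) :
    γ * (stationary σ).reachValue B x ≤ Γ.minReachValue B x := by
  refine mul_reachValue_le (ne_top_of_le_ne_top ENNReal.one_ne_top hγ)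
    (fun x hx => hγ.trans (minReachValue_of_mem hx).ge) (fun x hx => ?_) x
  rcases le_or_gt (Γ.minReachValue B x) γ with hle | hlt
  · refine .inr ?_
    rintro _ rfl
    rw [hστ x hle, ← hτB]
    exact lintegral_reachValue_stationary_le hx
  · exact .inl ((mul_le_of_le_one_right' (reachValue_le_one x)).trans hlt.le)

variable [DiscreteMeasurableSpace S]

lemma reachValue_union_le (T U : Set S) (x : S) :
    Γ.reachValue (T ∪ U) x ≤ Γ.reachValue T x + Γ.reachValue U x := by
  refine reachValue_le (f := fun x => Γ.reachValue T x + Γ.reachValue U x) (fun x hx => ?_)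
    (fun x hx p hp => ?_) x
  · rcases hx with hx | hx
    · exact (reachValue_of_mem hx).ge.trans le_self_add
    · exact (reachValue_of_mem hx).ge.trans le_add_self
  · rw [lintegral_add_left .of_discrete]
    exact add_le_add (lintegral_reachValue_le (fun h => hx (.inl h)) hp)
      (lintegral_reachValue_le (fun h => hx (.inr h)) hp)

lemma IsSelector.mul_reachValue_le_commit_minReachValue (hτ : Γ.IsSelector τ)
    (hτB : (stationary τ).reachValue B = Γ.minReachValue B) (hγδ : γ + δ = 1) (hη : η ≠ 0)
    (x : S) :
    δ * Γ.reachValue {y | Γ.minReachValue B y ≤ γ} x ≤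
      (Γ.commit {y | Γ.minReachValue B y ≤ γ} τ).reachValue {y | Γ.minReachValue B y ≤ η} x := by
  have hγ : γ ≠ ∞ := ne_top_of_le_ne_top ENNReal.one_ne_top (hγδ ▸ le_self_add)
  refine mul_reachValue_le_commit hτ (hγδ ▸ le_add_self) Set.subset_union_left (fun y hy => ?_) x
  refine (mul_le_of_le_one_right' (reachValue_le_one y)).trans ?_
  rw [← ENNReal.add_le_add_iff_left hγ, hγδ, add_comm]
  calc 1 ≤ (stationary τ).reachValue ({z | Γ.minReachValue B z ≤ η} ∪ B) y :=
        hτ.one_le_reachValue_stationary_union hη y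
    _ ≤ (stationary τ).reachValue {z | Γ.minReachValue B z ≤ η} y +
          (stationary τ).reachValue B y := reachValue_union_le _ _ y
    _ ≤ (stationary τ).reachValue {z | Γ.minReachValue B z ≤ η} y + γ := by
        gcongr
        exact hτB ▸ hy

/-- One follows a selector minimizing the probability of reaching `B` in the states from which this
probability is at most `γ`, and elsewhere a selector that is nearly optimal for reaching states
where it is even at most `η`. -/
theorem IsFinitary.exists_isSelector_switching [Countable S] (hΓ : Γ.IsFinitary)
    (hγδ : γ + δ = 1) (hη : η ≠ 0) (hκ : κ < 1) (B : Set S) :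
    ∃ σ, Γ.IsSelector σ ∧ (∀ x, γ * (stationary σ).reachValue B x ≤ Γ.minReachValue B x) ∧
      ∀ x, κ * (δ * Γ.reachValue {y | Γ.minReachValue B y ≤ γ} x) ≤
        (stationary σ).reachValue {y | Γ.minReachValue B y ≤ η} x := by
  obtain ⟨τ, hτ, hτB⟩ := hΓ.exists_isSelector_reachValue_eq_minReachValue B
  obtain ⟨σ, hσ, hσ_reach⟩ := (hΓ.commit (A := {y | Γ.minReachValue B y ≤ γ})
    hτ).exists_isSelector_mul_reachValue_le hκ {y | Γ.minReachValue B y ≤ η}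
  refine ⟨σ, fun x => hτ.commit_subset x (hσ x), ?_, fun x => le_trans ?_ (hσ_reach x)⟩
  · exact mul_reachValue_stationary_le_minReachValue hτB (hγδ ▸ le_self_add)
      fun x hx => hσ.eq_of_mem_commit hx
  · gcongr
    exact hτ.mul_reachValue_le_commit_minReachValue hτB hγδ hη x

end Switching

end GamblingHouse

namespace MDP

open GamblingHouse (stationary)

variable {S : Type*}

section Strategies

variable {M : MDP S}

open Classical in
/-- The gambling house of an MDP: the player moves to a successor of his choice, and in a random
state there is no choice. Randomizing between successors adds nothing to its values. -/
noncomputable def gambles (M : MDP S) : GamblingHouse S :=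
  fun x => if h : x ∈ M.player then PMF.pure '' {t | M.step x t} else {M.prob ⟨x, h⟩}

lemma gambles_of_mem {x : S} (hx : x ∈ M.player) :
    M.gambles x = PMF.pure '' {t | M.step x t} :=
  dif_pos hx

lemma gambles_of_notMem {x : S} (hx : x ∉ M.player) : M.gambles x = {M.prob ⟨x, hx⟩} :=
  dif_neg hx

lemma gambles_isFinitary (hM : ∀ s ∈ M.player, {t | M.step s t}.Finite) :
    M.gambles.IsFinitary where
  nonempty x := by
    by_cases hx : x ∈ M.player
    · rw [gambles_of_mem hx]
      exact Set.Nonempty.image _ (M.exists_step x)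
    · rw [gambles_of_notMem hx]
      exact Set.singleton_nonempty _
  finite x := by
    by_cases hx : x ∈ M.player
    · rw [gambles_of_mem hx]
      exact (hM x hx).image _
    · rw [gambles_of_notMem hx]
      exact Set.finite_singleton _

lemma exists_pure_eq_of_isSelector {τ : S → PMF S} (hτ : M.gambles.IsSelector τ) (x : M.player) :
    ∃ t, M.step x t ∧ PMF.pure t = τ x := by
  simpa [gambles_of_mem x.2] using hτ x

/-- The memoryless strategy given by a choice of gambles. -/
noncomputable def Strategy.ofSelector {τ : S → PMF S} (hτ : M.gambles.IsSelector τ) :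
    M.Strategy where
  act _ s := τ s
  step_of_mem_support _ s t ht := by
    obtain ⟨u, hu, heq⟩ := exists_pure_eq_of_isSelector hτ s
    rw [← heq, PMF.support_pure, Set.mem_singleton_iff] at ht
    exact ht ▸ hu

lemma Strategy.isMD_ofSelector {τ : S → PMF S} (hτ : M.gambles.IsSelector τ) :
    (ofSelector hτ).IsMD :=
  ⟨⟨fun s => τ s, fun _ _ => rfl⟩, fun _ s =>
    (exists_pure_eq_of_isSelector hτ s).imp fun _ h => h.2.symm⟩

lemma Strategy.next_ofSelector {τ : S → PMF S} (hτ : M.gambles.IsSelector τ) (w : List S)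
    (x : S) : (ofSelector hτ).next w x = τ x := by
  by_cases hx : x ∈ M.player
  · exact dif_pos hx
  · have hτx : τ x = M.prob ⟨x, hx⟩ := by simpa [gambles_of_notMem hx] using hτ x
    exact (dif_neg hx).trans hτx.symm

variable [MeasurableSpace S] [DiscreteMeasurableSpace S] {f : S → ℝ≥0∞} {c : ℝ≥0∞} {x : S}

lemma Strategy.ae_pure_mem_gambles (σ : M.Strategy) (w : List S) (x : M.player) :
    ∀ᵐ y ∂(σ.act w x).toMeasure, PMF.pure y ∈ M.gambles x := by
  rw [← PMF.restrict_toMeasure_support]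
  filter_upwards [ae_restrict_mem .of_discrete] with y hy
  rw [gambles_of_mem x.2]
  exact Set.mem_image_of_mem _ (σ.step_of_mem_support w x y hy)

lemma Strategy.lintegral_next_le (σ : M.Strategy) (w : List S)
    (hc : ∀ p ∈ M.gambles x, ∫⁻ y, f y ∂p.toMeasure ≤ c) :
    ∫⁻ y, f y ∂(σ.next w x).toMeasure ≤ c := by
  by_cases hx : x ∈ M.player
  · have le_c : ∀ᵐ y ∂(σ.act w ⟨x, hx⟩).toMeasure, f y ≤ c := by
      filter_upwards [σ.ae_pure_mem_gambles w ⟨x, hx⟩] with y hy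
      simpa [PMF.toMeasure_pure] using hc _ hy
    rw [next, dif_pos hx]
    exact (lintegral_mono_ae le_c).trans_eq (by simp)
  · rw [next, dif_neg hx]
    exact hc _ (by rw [gambles_of_notMem hx]; rfl)

lemma Strategy.le_lintegral_next (σ : M.Strategy) (w : List S)
    (hc : ∀ p ∈ M.gambles x, c ≤ ∫⁻ y, f y ∂p.toMeasure) :
    c ≤ ∫⁻ y, f y ∂(σ.next w x).toMeasure := by
  by_cases hx : x ∈ M.player
  · have c_le : ∀ᵐ y ∂(σ.act w ⟨x, hx⟩).toMeasure, c ≤ f y := by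
      filter_upwards [σ.ae_pure_mem_gambles w ⟨x, hx⟩] with y hy
      simpa [PMF.toMeasure_pure] using hc _ hy
    rw [next, dif_pos hx]
    exact le_trans (by simp) (lintegral_mono_ae c_le)
  · rw [next, dif_neg hx]
    exact hc _ (by rw [gambles_of_notMem hx]; rfl)

end Strategies

section Plays

/-- The plays that visit `A` at some time in `I`. -/
def visits (A : Set S) (I : Set ℕ) : Set (ℕ → S) :=
  {w | ∃ i ∈ I, w i ∈ A}

/-- The co-Büchi objective: the plays that visit `B` only finitely often. -/
def coBuchi (B : Set S) : Set (ℕ → S) :=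
  {w | ∀ᶠ i in atTop, w i ∉ B}

lemma visits_mono {A : Set S} {I J : Set ℕ} (hIJ : I ⊆ J) : visits A I ⊆ visits A J :=
  fun _ ⟨i, hi, hA⟩ => ⟨i, hIJ hi, hA⟩

lemma visits_iUnion {ι : Type*} (A : Set S) (I : ι → Set ℕ) :
    visits A (⋃ k, I k) = ⋃ k, visits A (I k) := by
  ext w
  simp only [visits, Set.mem_iUnion, Set.mem_ofPred_eq]
  tauto

lemma compl_visits_subset_coBuchi (B : Set S) (n : ℕ) : (visits B (Set.Ici n))ᶜ ⊆ coBuchi B :=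
  fun _ hw => eventually_atTop.2 ⟨n, fun i hi hB => hw ⟨i, hi, hB⟩⟩

lemma parity_eq_coBuchi {col : S → ℕ} (hcol : ∀ s, col s ∈ ({0, 1} : Set ℕ)) :
    parity col = coBuchi {s | col s ≠ 0} := by
  have col_le_one (s : S) : col s ≤ 1 :=
    (hcol s).elim (fun h => h.trans_le zero_le_one) fun h => Eq.le h
  ext w
  constructor
  · rintro ⟨i, hfreq, hle⟩
    obtain ⟨m, hm⟩ := hfreq.exists
    have := col_le_one (w m)
    exact hle.mono fun n hn => not_not.2 (by omega)
  · intro hw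
    have col_eq_zero : ∀ᶠ n in atTop, col (w n) = 0 := hw.mono fun n hn => not_not.1 hn
    exact ⟨0, col_eq_zero.frequently, col_eq_zero.mono fun n hn => hn.le⟩

variable [MeasurableSpace S] [DiscreteMeasurableSpace S]

lemma measurableSet_visits (A : Set S) (I : Set ℕ) : MeasurableSet (visits A I) := by
  have : visits A I = ⋃ i ∈ I, (fun w : ℕ → S => w i) ⁻¹' A := by
    ext w
    simp [visits]
  rw [this]
  exact .biUnion I.to_countable fun i _ => measurable_pi_apply i .of_discrete

lemma measurableSet_coBuchi (B : Set S) : MeasurableSet (coBuchi B) := by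
  have : coBuchi B = ⋃ n, (visits B (Set.Ici n))ᶜ := by
    ext w
    simp [coBuchi, visits, eventually_atTop]
  rw [this]
  exact .iUnion fun n => (measurableSet_visits B _).compl

end Plays

/-- The states at the times `0, …, n`, in the form in which they enter `Strategy.kernel`. -/
abbrev History (S : Type*) (n : ℕ) :=
  (i : Finset.Iic n) → (fun _ : ℕ => S) i

namespace History

variable {n : ℕ}

/-- The current state. -/
def last (h : History S n) : S :=
  h ⟨n, Finset.mem_Iic.2 le_rfl⟩

/-- The states before the current one, the oldest first. -/
def past (h : History S n) : List S :=
  List.ofFn fun i : Fin n => h ⟨i, Finset.mem_Iic.2 i.isLt.le⟩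

variable [MeasurableSpace S]

/-- The history `h` followed by the state `y`. -/
def extend (h : History S n) (y : S) : History S (n + 1) :=
  IicProdIoc (X := fun _ => S) n (n + 1) (h, MeasurableEquiv.piSingleton (X := fun _ => S) n y)

lemma last_extend (h : History S n) (y : S) : (h.extend y).last = y := by
  simp [last, extend, IicProdIoc, MeasurableEquiv.piSingleton]

end History

section After

variable [Countable S] [MeasurableSpace S] [DiscreteMeasurableSpace S] {M : MDP S} {n : ℕ}

/-- The law of the play under `σ` after the history `h`. -/
noncomputable def Strategy.after (σ : M.Strategy) (h : History S n) : Measure (ℕ → S) :=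
  Kernel.traj (X := fun _ => S) σ.kernel n h

instance (σ : M.Strategy) (h : History S n) : IsProbabilityMeasure (σ.after h) :=
  inferInstanceAs (IsProbabilityMeasure (Kernel.traj (X := fun _ => S) σ.kernel n h))

lemma Strategy.ae_after_eq_last (σ : M.Strategy) (h : History S n) :
    ∀ᵐ w ∂σ.after h, w n = h.last := by
  have map_after :
      (σ.after h).map (Preorder.frestrictLe (π := fun _ => S) n) = Measure.dirac h := by
    rw [after, Kernel.traj_map_frestrictLe_apply, Kernel.partialTraj_self, Kernel.id_apply]
  have ae_eq : ∀ᵐ g ∂(σ.after h).map (Preorder.frestrictLe (π := fun _ => S) n), g = h := by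
    rw [map_after, ae_dirac_eq]
    rfl
  filter_upwards [ae_of_ae_map (by fun_prop) ae_eq] with w hw
  exact congrFun hw ⟨n, Finset.mem_Iic.2 le_rfl⟩

lemma Strategy.after_eq_lintegral (σ : M.Strategy) (h : History S n) {E : Set (ℕ → S)}
    (hE : MeasurableSet E) :
    σ.after h E = ∫⁻ y, σ.after (h.extend y) E ∂(σ.next h.past h.last).toMeasure := by
  have : IsMarkovKernel ((σ.kernel n).map (MeasurableEquiv.piSingleton (X := fun _ => S) n)) :=
    Kernel.IsMarkovKernel.map _ (MeasurableEquiv.measurable _)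
  rw [after, ← Kernel.traj_comp_partialTraj (Nat.le_succ n), Kernel.comp_apply' _ _ _ hE,
    Nat.succ_eq_add_one, Kernel.partialTraj_succ_self,
    Kernel.lintegral_map _ (by fun_prop) _ (Kernel.measurable_coe _ hE),
    Kernel.lintegral_id_prod, Kernel.lintegral_map]
  · rfl
  all_goals fun_prop

lemma Strategy.one_le_after_visits (σ : M.Strategy) {A : Set S} {h : History S n}
    (hA : h.last ∈ A) : 1 ≤ σ.after h (visits A (Set.Ici n)) := by
  rw [← measure_univ (μ := σ.after h)]
  refine measure_mono_ae ?_
  filter_upwards [σ.ae_after_eq_last h] with w hw _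
  exact ⟨n, Set.self_mem_Ici, hw ▸ hA⟩

lemma Strategy.after_visits_Ico_le (σ : M.Strategy) {A : Set S} {f : S → ℝ≥0∞}
    (hA : ∀ x ∈ A, 1 ≤ f x) (hf : ∀ w, ∀ x ∉ A, ∫⁻ y, f y ∂(σ.next w x).toMeasure ≤ f x)
    (k : ℕ) (h : History S n) : σ.after h (visits A (Set.Ico n (n + k))) ≤ f h.last := by
  induction k generalizing n with
  | zero => simp [visits]
  | succ k ih =>
    by_cases hlast : h.last ∈ A
    · exact prob_le_one.trans (hA _ hlast)
    calc σ.after h (visits A (Set.Ico n (n + (k + 1))))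
        ≤ σ.after h (visits A (Set.Ico (n + 1) (n + 1 + k))) := by
          refine measure_mono_ae ?_
          filter_upwards [σ.ae_after_eq_last h] with w hw
          rintro ⟨i, ⟨hni, hik⟩, hiA⟩
          have hin : i ≠ n := by
            rintro rfl
            exact hlast (hw ▸ hiA)
          exact ⟨i, ⟨by omega, by omega⟩, hiA⟩
      _ = ∫⁻ y, σ.after (h.extend y) (visits A (Set.Ico (n + 1) (n + 1 + k)))
            ∂(σ.next h.past h.last).toMeasure :=
          σ.after_eq_lintegral h (measurableSet_visits _ _)
      _ ≤ ∫⁻ y, f y ∂(σ.next h.past h.last).toMeasure := lintegral_mono fun y =>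
          (ih (h.extend y)).trans_eq (by rw [h.last_extend])
      _ ≤ f h.last := hf _ _ hlast

lemma Strategy.after_visits_le (σ : M.Strategy) {A : Set S} {f : S → ℝ≥0∞}
    (hA : ∀ x ∈ A, 1 ≤ f x) (hf : ∀ w, ∀ x ∉ A, ∫⁻ y, f y ∂(σ.next w x).toMeasure ≤ f x)
    (h : History S n) : σ.after h (visits A (Set.Ici n)) ≤ f h.last := by
  have hmono : Monotone fun k => visits A (Set.Ico n (n + k)) := fun _ _ hkl =>
    visits_mono (Set.Ico_subset_Ico_right (Nat.add_le_add_left hkl n))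
  have hIci : Set.Ici n = ⋃ k, Set.Ico n (n + k) := by
    ext i
    simp only [Set.mem_Ici, Set.mem_iUnion, Set.mem_Ico]
    exact ⟨fun hi => ⟨i + 1, hi, by omega⟩, fun ⟨_, hi, _⟩ => hi⟩
  rw [hIci, visits_iUnion, hmono.measure_iUnion]
  exact iSup_le fun k => σ.after_visits_Ico_le hA hf k h

/-- The worst probability, over all histories that end in `x`, with which the rest of the play
realizes the objective; the objective `E n` may depend on the length `n` of the history. -/
noncomputable def Strategy.infAfter (σ : M.Strategy) (E : ℕ → Set (ℕ → S)) (x : S) : ℝ≥0∞ :=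
  ⨅ (n : ℕ) (h : History S n) (_ : h.last = x), σ.after h (E n)

variable {E : ℕ → Set (ℕ → S)} {c : ℝ≥0∞} {x : S}

lemma Strategy.infAfter_le (σ : M.Strategy) (E : ℕ → Set (ℕ → S)) (h : History S n) :
    σ.infAfter E h.last ≤ σ.after h (E n) :=
  iInf_le_of_le n (iInf_le_of_le h (iInf_le _ rfl))

lemma Strategy.le_infAfter {σ : M.Strategy}
    (hc : ∀ (n : ℕ) (h : History S n), h.last = x → c ≤ σ.after h (E n)) : c ≤ σ.infAfter E x :=
  le_iInf fun n => le_iInf₂ (hc n)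

lemma Strategy.le_infAfter_of_le_lintegral_next {σ : M.Strategy} (hE : ∀ n, MeasurableSet (E n))
    (hanti : ∀ n, E (n + 1) ⊆ E n)
    (hc : ∀ w, c ≤ ∫⁻ y, σ.infAfter E y ∂(σ.next w x).toMeasure) : c ≤ σ.infAfter E x := by
  refine le_infAfter fun n h hx => ?_
  subst hx
  calc c ≤ ∫⁻ y, σ.infAfter E y ∂(σ.next h.past h.last).toMeasure := hc h.past
    _ ≤ ∫⁻ y, σ.after (h.extend y) (E n) ∂(σ.next h.past h.last).toMeasure :=
        lintegral_mono fun y => calc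
          σ.infAfter E y = σ.infAfter E (h.extend y).last := by rw [h.last_extend]
          _ ≤ σ.after (h.extend y) (E (n + 1)) := σ.infAfter_le E (h.extend y)
          _ ≤ σ.after (h.extend y) (E n) := measure_mono (hanti n)
    _ = σ.after h (E n) := (σ.after_eq_lintegral h (hE n)).symm

end After

section CoBuchi

variable [Countable S] [MeasurableSpace S] [DiscreteMeasurableSpace S] {M : MDP S} {n : ℕ}
  {A B T : Set S} {γ δ κ : ℝ≥0∞}

lemma Strategy.after_visits_le_reachValue (σ : M.Strategy) (A : Set S) (h : History S n) :
    σ.after h (visits A (Set.Ici n)) ≤ M.gambles.reachValue A h.last :=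
  σ.after_visits_le (fun _ hx => (GamblingHouse.reachValue_of_mem hx).ge)
    (fun w _ hx => σ.lintegral_next_le w fun _ hp => GamblingHouse.lintegral_reachValue_le hx hp) h

lemma Strategy.after_ofSelector_visits_le {τ : S → PMF S} (hτ : M.gambles.IsSelector τ) (A : Set S)
    (h : History S n) :
    (ofSelector hτ).after h (visits A (Set.Ici n)) ≤ (stationary τ).reachValue A h.last :=
  after_visits_le _ (fun _ hx => (GamblingHouse.reachValue_of_mem hx).ge)
    (fun w x hx => by
      rw [next_ofSelector]
      exact GamblingHouse.lintegral_reachValue_stationary_le hx) h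

lemma Strategy.minReachValue_le_after_visits (hM : M.gambles.IsFinitary) (σ : M.Strategy)
    (A : Set S) (h : History S n) :
    M.gambles.minReachValue A h.last ≤ σ.after h (visits A (Set.Ici n)) := by
  refine (GamblingHouse.minReachValue_le (f := σ.infAfter fun n => visits A (Set.Ici n))
    (fun x hx => le_infAfter fun n h hlast => σ.one_le_after_visits (hlast ▸ hx))
    (fun x _ => ?_) h.last).trans (σ.infAfter_le _ h)
  obtain ⟨τ, hτ, hmin⟩ := hM.exists_isSelector_forall_le
    fun p => ∫⁻ y, σ.infAfter (fun n => visits A (Set.Ici n)) y ∂p.toMeasure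
  exact ⟨τ x, hτ x, le_infAfter_of_le_lintegral_next (fun n => measurableSet_visits A _)
    (fun n => visits_mono (Set.Ici_subset_Ici.2 n.le_succ)) fun w =>
      σ.le_lintegral_next w (hmin x)⟩

lemma Strategy.after_visits_add_eq_one (hM : M.gambles.IsFinitary)
    (hA : ∀ x, 1 ≤ M.gambles.minReachValue A x) (σ : M.Strategy) (k : ℕ) (h : History S n) :
    σ.after h (visits A (Set.Ici (n + k))) = 1 := by
  induction k generalizing n with
  | zero => exact le_antisymm prob_le_one ((hA _).trans (σ.minReachValue_le_after_visits hM A h))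
  | succ k ih =>
    rw [σ.after_eq_lintegral h (measurableSet_visits A _), show n + (k + 1) = n + 1 + k by omega]
    simp [ih]

lemma Strategy.ae_frequently_mem (hM : M.gambles.IsFinitary)
    (hA : ∀ x, 1 ≤ M.gambles.minReachValue A x) (σ : M.Strategy) (h : History S n) :
    ∀ᵐ w ∂σ.after h, ∃ᶠ i in atTop, w i ∈ A := by
  have ae_visits : ∀ k, ∀ᵐ w ∂σ.after h, w ∈ visits A (Set.Ici (n + k)) := fun k =>
    (prob_compl_eq_zero_iff (measurableSet_visits A _)).2 (σ.after_visits_add_eq_one hM hA k h)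
  filter_upwards [ae_all_iff.2 ae_visits] with w hw
  refine frequently_atTop.2 fun k => ?_
  obtain ⟨i, hi, hiA⟩ := hw k
  exact ⟨i, (Nat.le_add_left k n).trans hi, hiA⟩

lemma Strategy.after_coBuchi_le (hM : M.gambles.IsFinitary) (σ : M.Strategy) (hγ : γ ≠ 0)
    (h : History S n) :
    σ.after h (coBuchi B) ≤
      M.gambles.reachValue {x | M.gambles.minReachValue B x ≤ γ} h.last := by
  refine le_trans (measure_mono_ae ?_) (σ.after_visits_le_reachValue _ h)
  filter_upwards [σ.ae_frequently_mem hM (fun x => hM.one_le_minReachValue_union (B := B) hγ x) h]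
    with w hfreq hw
  obtain ⟨i, ⟨hmem, hnotB⟩, hni⟩ :=
    ((hfreq.and_eventually hw).and_eventually (eventually_ge_atTop n)).exists
  exact ⟨i, hni, hmem.resolve_right hnotB⟩

lemma Strategy.mul_reachValue_le_after_coBuchi {τ : S → PMF S} (hτ : M.gambles.IsSelector τ)
    (hγδ : γ + δ = 1) (hT : ∀ x ∈ T, (stationary τ).reachValue B x ≤ γ) (h : History S n) :
    δ * (stationary τ).reachValue T h.last ≤ (ofSelector hτ).after h (coBuchi B) := by
  have hγ : γ ≠ ∞ := ne_top_of_le_ne_top ENNReal.one_ne_top (hγδ ▸ le_self_add)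
  have hδ : δ ≠ ∞ := ne_top_of_le_ne_top ENNReal.one_ne_top (hγδ ▸ le_add_self)
  refine (GamblingHouse.mul_reachValue_le hδ (g := (ofSelector hτ).infAfter fun _ => coBuchi B)
    (fun x hx => le_infAfter fun n h hlast => ?_) (fun x _ => .inr ?_) h.last).trans
    (infAfter_le _ _ h)
  · subst hlast
    have visits_le : (ofSelector hτ).after h (visits B (Set.Ici n)) ≤ γ :=
      (after_ofSelector_visits_le hτ B h).trans (hT _ hx)
    rw [← ENNReal.add_le_add_iff_left hγ]
    calc γ + δ = (ofSelector hτ).after h (visits B (Set.Ici n)) +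
          (ofSelector hτ).after h (visits B (Set.Ici n))ᶜ := by
          rw [hγδ, prob_add_prob_compl (measurableSet_visits B _)]
      _ ≤ γ + (ofSelector hτ).after h (coBuchi B) :=
          add_le_add visits_le (measure_mono (compl_visits_subset_coBuchi B n))
  · rintro _ rfl
    exact le_infAfter_of_le_lintegral_next (fun _ => measurableSet_coBuchi B) (fun _ => le_rfl)
      fun w => by rw [next_ofSelector hτ w x]

theorem exists_isMD_forall_mul_measure_coBuchi_le (hM : M.gambles.IsFinitary) (hκ : κ < 1)
    (B : Set S) :
    ∃ σ : M.Strategy, σ.IsMD ∧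
      ∀ (σ' : M.Strategy) s, κ * σ'.measure s (coBuchi B) ≤ σ.measure s (coBuchi B) := by
  obtain ⟨δ, hδ, rfl⟩ : ∃ δ < 1, δ ^ 3 = κ :=
    ⟨κ ^ ((3 : ℕ) : ℝ)⁻¹, ENNReal.rpow_lt_one hκ (by positivity),
      ENNReal.rpow_inv_natCast_pow three_ne_zero κ⟩
  set γ := 1 - δ
  have hγδ : γ + δ = 1 := tsub_add_cancel_of_le hδ.le
  have hγ0 : γ ≠ 0 := (tsub_pos_of_lt hδ).ne'
  have hγ : γ ≠ ∞ := ENNReal.sub_ne_top ENNReal.one_ne_top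
  obtain ⟨τ, hτ, hτB, hτ_reach⟩ :=
    hM.exists_isSelector_switching hγδ (mul_ne_zero hγ0 hγ0) hδ B
  refine ⟨.ofSelector hτ, Strategy.isMD_ofSelector hτ, fun σ' s => ?_⟩
  calc δ ^ 3 * σ'.measure s (coBuchi B)
      ≤ δ ^ 3 * M.gambles.reachValue {x | M.gambles.minReachValue B x ≤ γ} s := by
        gcongr
        exact σ'.after_coBuchi_le hM hγ0 (n := 0) fun _ => s
    _ = δ * (δ * (δ * M.gambles.reachValue {x | M.gambles.minReachValue B x ≤ γ} s)) := by ring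
    _ ≤ δ * (stationary τ).reachValue {x | M.gambles.minReachValue B x ≤ γ * γ} s := by
        gcongr
        exact hτ_reach s
    _ ≤ (Strategy.ofSelector hτ).measure s (coBuchi B) :=
        Strategy.mul_reachValue_le_after_coBuchi hτ hγδ
          (fun x hx => (ENNReal.mul_le_mul_iff_right hγ0 hγ).1 ((hτB x).trans hx)) (n := 0)
          fun _ => s

end CoBuchi

section Value

variable [Countable S] [MeasurableSpace S] [DiscreteMeasurableSpace S] {M : MDP S}
  {φ : Set (ℕ → S)} {s : S}

instance (σ : M.Strategy) : IsProbabilityMeasure (σ.measure s) :=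
  inferInstanceAs (IsProbabilityMeasure (σ.after (n := 0) fun _ => s))

lemma value_le_one : M.value φ s ≤ 1 :=
  Real.iSup_le (fun _ => measureReal_le_one) zero_le_one

lemma Strategy.isEpsOptimal_of_one_sub_mul_value_le {σ : M.Strategy} {ε : ℝ} (hε : 0 ≤ ε)
    (h : (1 - ε) * M.value φ s ≤ (σ.measure s).real φ) : σ.IsEpsOptimal φ ε s := by
  rw [IsEpsOptimal, ge_iff_le]
  linarith [mul_le_mul_of_nonneg_left (value_le_one (M := M) (φ := φ) (s := s)) hε]

lemma mul_value_le {κ r : ℝ} (hr : 0 ≤ r)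
    (h : ∀ σ : M.Strategy, κ * (σ.measure s).real φ ≤ r) : κ * M.value φ s ≤ r := by
  rcases le_total 0 κ with hκ | hκ
  · rw [value, Real.mul_iSup_of_nonneg hκ]
    exact Real.iSup_le h hr
  · have value_nonneg : 0 ≤ M.value φ s := Real.iSup_nonneg fun _ => measureReal_nonneg
    exact (mul_nonpos_of_nonpos_of_nonneg hκ value_nonneg).trans hr

end Value

end MDP

theorem mainTheorem4_general {S : Type*} [Countable S] [MeasurableSpace S]
    [DiscreteMeasurableSpace S] (M : MDP S) (hM : ∀ s ∈ M.player, {t | M.step s t}.Finite)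
    (col : S → ℕ) (hcol : ∀ s, col s ∈ ({0, 1} : Set ℕ)) (κ : ℝ) (hκ : κ < 1) :
    ∃ σ : M.Strategy, σ.IsMD ∧
      ∀ s : S, κ * M.value (parity col) s ≤ (σ.measure s).real (parity col) := by
  obtain ⟨σ, hσ, hle⟩ := MDP.exists_isMD_forall_mul_measure_coBuchi_le (MDP.gambles_isFinitary hM)
    (ENNReal.ofReal_lt_one.2 hκ) {s | col s ≠ 0}
  rw [← MDP.parity_eq_coBuchi hcol] at hle
  refine ⟨σ, hσ, fun s => MDP.mul_value_le measureReal_nonneg fun σ' => ?_⟩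
  calc κ * (σ'.measure s).real (parity col)
      ≤ (ENNReal.ofReal κ * σ'.measure s (parity col)).toReal := by
        rw [ENNReal.toReal_mul, ENNReal.toReal_ofReal']
        gcongr
        · exact le_max_left κ 0
        · rfl
    _ ≤ (σ.measure s).real (parity col) := ENNReal.toReal_mono (measure_ne_top _ _) (hle σ' s)

theorem mainTheorem4 {S : Type*} [Countable S] [MeasurableSpace S] [DiscreteMeasurableSpace S]
    (M : MDP S) (hM : M.FinitelyBranching)
    (col : S → ℕ) (hcol : ∀ s, col s ∈ ({0, 1} : Set ℕ))
    (ε : ℝ) (hε : 0 < ε) :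
    ∃ σ : M.Strategy, σ.IsMD ∧ ∀ s : S, σ.IsEpsOptimal (parity col) ε s := by
  obtain ⟨σ, hσ, hle⟩ :=
    mainTheorem4_general M (fun s _ => hM s) col hcol (1 - ε) (sub_lt_self 1 hε)
  exact ⟨σ, hσ, fun s => σ.isEpsOptimal_of_one_sub_mul_value_le hε.le (hle s)⟩
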